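/- An *o-graph* is a finite 4-valent graph (loops and multiple edges allowed) with, at each vertex, an embedding of its neighbourhood in the oriented plane, one of the two pairs of opposite strands being marked as the overstrand (the other pair is the understrand), and with a colour in $\mathbb Z/3$ on each edge. It defines an oriented standard polyhedron as follows. Near a vertex one takes the horizontal plane with a vertical wall attached from above along the overstrand and one from below along the understrand; thus three sheets (left, right, wall) meet along each germ of edge at the vertex. Along an edge the three sheets at one end are glued to those at the other end by a bijection compatible with the orientation of space, i.e. with the cyclic orders of the three sheets around the edge; colour $0$ means that wall is glued to wall, and colour $c$ that a further left-handed screw by $c/3$ of a full turn is inserted. A *C-move* at a vertex with germs $a,b,c,d$ in counterclockwise order changes the planar structure there so that the counterclockwise order becomes $a,c,d,b$ (so the strands $\{a,c\},\{b,d\}$ become $\{a,d\},\{b,c\}$), with the strand of $a$ over if and only if it was over before; the colour of an edge changes by $-1$ if $a$ is over, and by $+1$ if $a$ is under, once for each end of that edge at the vertex. Finite sequences of C-moves at a vertex produce the $6$ planar structures there that are compatible with the orientation. The *mirror* $-\Gamma$ of an o-graph $\Gamma$ is obtained by switching over- and understrands at all vertices and replacing each colour by its opposite in $\mathbb Z/3$.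 For $n\ge 1$, $\alpha,\delta\in\mathbb Z/3$ and $\beta_k,\gamma_k\in\mathbb Z/3$ ($1\le k\le n-1$), let $\Gamma_n(\alpha,\beta,\gamma,\delta)$ be the o-graph drawn as a horizontal row of crossings $v_1,\dots,v_n$ of shape X, in each of which the strand from lower left to upper right is over. The two left germs of $v_1$ are joined by an edge of colour $\alpha$, the two right germs of $v_n$ by an edge of colour $\delta$, the upper right germ of $v_k$ and the upper left germ of $v_{k+1}$ by an edge of colour $\beta_k$, and the lower right germ of $v_k$ and the lower left germ of $v_{k+1}$ by an edge of colour $\gamma_k$. **Proposition.** Let $\Gamma=\Gamma_n(\alpha,\beta,\gamma,\delta)$ and let $\Gamma'=\Gamma_n(\alpha',\beta',\gamma',\delta')$, where $\alpha'=1-\alpha$, $\delta'=1-\delta$, and $$\beta'_{k}=1-\gamma_{k},\quad \gamma'_{k}=1-\beta_{k}\quad (k\text{ odd}),\qquad \beta'_{k}=1-\beta_{k},\quad \gamma'_{k}=1-\gamma_{k}\quad (k\text{ even}).$$ Then, up to C-moves, $-\Gamma$ is $\Gamma'$: an o-graph obtained from $-\Gamma$ by C-moves at its vertices is combinatorially identical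 to $\Gamma'$. In particular $-\Gamma$ and $\Gamma'$ define isomorphic oriented standard polyhedra. -/

import Mathlib

/-- An o-graph with vertex set `V`: a finite 4-valent graph (loops and multiple edges allowed)
in which the neighbourhood of each vertex is embedded in the oriented plane, one of the two pairs
of opposite strands at each vertex is marked as being over the other, and each edge carries a
colour in `ℤ/3`. The graph is encoded by the set `H` of its germs of edges at vertices
(half-edges). -/
@[ext]
structure OGraph (V H : Type*) where
  /-- There are finitely many vertices. -/
  finite_vertices : Finite V
  /-- The vertex at which a germ is based. -/
  vert : H → V
  vert_surjective : Function.Surjective vert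
  /-- The other germ of the edge containing a given germ. -/
  opp : H → H
  opp_opp : ∀ h, opp (opp h) = h
  opp_ne : ∀ h, opp h ≠ h
  /-- The next germ at the same vertex, counterclockwise in the planar embedding. -/
  next : Equiv.Perm H
  /-- The germs at a vertex form a single cycle of `next`. -/
  vert_eq_iff : ∀ h h', vert h = vert h' ↔ next.SameCycle h h'
  /-- This cycle has length four. -/
  next_next_ne : ∀ h, next (next h) ≠ h
  next_four : ∀ h, next (next (next (next h))) = h
  /-- Whether a germ belongs to the overstrand (`true`) or to the understrand (`false`). -/
  isOver : H → Bool
  isOver_next : ∀ h, isOver (next h) = !isOver h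
  /-- The colour of the edge containing a given germ. -/
  colour : H → ZMod 3
  colour_opp : ∀ h, colour (opp h) = colour h

namespace OGraph

variable {V H V' H' : Type*}

/-- The mirror `-Γ` of `Γ`: overstrands and understrands are switched and each colour is replaced
by its opposite in `ℤ/3`. -/
def mirror (Γ : OGraph V H) : OGraph V H where
  finite_vertices := Γ.finite_vertices
  vert := Γ.vert
  vert_surjective := Γ.vert_surjective
  opp := Γ.opp
  opp_opp := Γ.opp_opp
  opp_ne := Γ.opp_ne
  next := Γ.next
  vert_eq_iff := Γ.vert_eq_iff
  next_next_ne := Γ.next_next_ne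
  next_four := Γ.next_four
  isOver h := !Γ.isOver h
  isOver_next h := by simp [Γ.isOver_next]
  colour h := -Γ.colour h
  colour_opp h := by simp [Γ.colour_opp]

/-- Two o-graphs are combinatorially identical: there is an isomorphism of graphs preserving the
planar structures at the vertices, the overstrands and the colours. -/
structure Iso (Γ : OGraph V H) (Δ : OGraph V' H') where
  onVert : V ≃ V'
  onGerm : H ≃ H'
  vert_comm : ∀ h, Δ.vert (onGerm h) = onVert (Γ.vert h)
  opp_comm : ∀ h, Δ.opp (onGerm h) = onGerm (Γ.opp h)
  next_comm : ∀ h, Δ.next (onGerm h) = onGerm (Γ.next h)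
  isOver_comm : ∀ h, Δ.isOver (onGerm h) = Γ.isOver h
  colour_comm : ∀ h, Δ.colour (onGerm h) = Γ.colour h

theorem vert_next (Γ : OGraph V H) (h : H) : Γ.vert (Γ.next h) = Γ.vert h :=
  (Γ.vert_eq_iff _ _).2 (by simpa using Equiv.Perm.SameCycle.refl Γ.next h)

section Moves

variable [DecidableEq H]

/-- If `a, b, c, d` are the germs at the vertex of `a`, in counterclockwise order, this is the
permutation of the germs given by `b ↦ c ↦ d ↦ b`, with all other germs fixed. -/
def turnAbout (Γ : OGraph V H) (a : H) : Equiv.Perm H :=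
  Equiv.swap (Γ.next a) (Γ.next (Γ.next a)) *
    Equiv.swap (Γ.next (Γ.next a)) (Γ.next (Γ.next (Γ.next a)))

theorem vert_turnAbout (Γ : OGraph V H) (a h : H) : Γ.vert (Γ.turnAbout a h) = Γ.vert h := by
  have key : ∀ x y z : H, Γ.vert x = Γ.vert y → Γ.vert (Equiv.swap x y z) = Γ.vert z := by
    intro x y z hxy
    rw [Equiv.swap_apply_def]
    split_ifs with h1 h2
    · rw [h1, hxy]
    · rw [h2, hxy]
    · rfl
  simp only [turnAbout, Equiv.Perm.mul_apply]
  rw [key _ _ _ (by simp [vert_next]), key _ _ _ (by simp [vert_next])]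

theorem vert_turnAbout_symm (Γ : OGraph V H) (a h : H) :
    Γ.vert ((Γ.turnAbout a)⁻¹ h) = Γ.vert h := by
  simpa using (Γ.vert_turnAbout a ((Γ.turnAbout a)⁻¹ h)).symm

variable [DecidableEq V]

/-- The amount by which a C-move about `a` changes the colour at the germ `h`. -/
def shift (Γ : OGraph V H) (a h : H) : ZMod 3 :=
  if Γ.vert h = Γ.vert a then (if Γ.isOver a then -1 else 1) else 0

/-- The C-move about the germ `a`. It corresponds to redrawing the neighbourhood of the vertex of
`a` in the dual polyhedron after a rotation of order three about `a`: if the germs at this vertex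
are `a, b, c, d` in counterclockwise order, with `a, c` being one strand and `b, d` the other, then
after the move the counterclockwise order is `a, c, d, b`, the strands being `a, d` and `c, b`, and
the strand of `a` is over if and only if it was so before. Every germ at the vertex contributes
`-1` (if `a` is over) or `1` (if `a` is under) to the change of the colour of its edge; an edge
with both germs at the vertex receives both contributions. Finite sequences of these moves at a
vertex give the six planar structures compatible with the orientation. -/
def cMove (Γ : OGraph V H) (a : H) : OGraph V H where
  finite_vertices := Γ.finite_vertices
  vert := Γ.vert
  vert_surjective := Γ.vert_surjective
  opp := Γ.opp
  opp_opp := Γ.opp_opp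
  opp_ne := Γ.opp_ne
  next := Γ.turnAbout a * Γ.next * (Γ.turnAbout a)⁻¹
  vert_eq_iff h h' := by
    rw [Equiv.Perm.sameCycle_conj, ← Γ.vert_eq_iff, vert_turnAbout_symm, vert_turnAbout_symm]
  next_next_ne h := by
    intro e
    apply Γ.next_next_ne ((Γ.turnAbout a)⁻¹ h)
    apply (Γ.turnAbout a).injective
    simpa using e
  next_four h := by simp [Γ.next_four]
  isOver h := Γ.isOver ((Γ.turnAbout a)⁻¹ h)
  isOver_next h := by simp [Γ.isOver_next]
  colour h := Γ.colour h + Γ.shift a h + Γ.shift a (Γ.opp h)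
  colour_opp h := by rw [Γ.colour_opp, Γ.opp_opp]; ring

/-- `Δ` is obtained from `Γ` by a single C-move. -/
def CStep (Γ Δ : OGraph V H) : Prop := ∃ a, Δ = Γ.cMove a

/-- `Δ` is combinatorially identical to an o-graph obtained from `Γ` by C-moves at its vertices. -/
def CEquiv (Γ : OGraph V H) (Δ : OGraph V' H') : Prop :=
  ∃ Γ' : OGraph V H, Relation.ReflTransGen CStep Γ Γ' ∧ Nonempty (Iso Γ' Δ)

end Moves

/-! ### The oriented standard polyhedron defined by an o-graph

The polyhedron is the horizontal plane near each vertex, with a vertical wall attached from above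
along the overstrand and one attached from below along the understrand. So the four germs at the
vertex are its edges of triple points, and the sheets at the vertex are the six pairs of distinct
germs; the three sheets along a germ `h` correspond to the three other germs at the vertex, the
wall being the sheet spanned by `h` and the opposite germ. Along an edge the three sheets at one
end are glued to those at the other end. -/

/-- The three sheets along the germ `h`, each given by the second germ that it contains. The sheet
of index `0` is the vertical wall, and the indices increase clockwise for an observer who leaves
the vertex along `h`. -/
def sheet (Γ : OGraph V H) (h : H) (i : ZMod 3) : H :=
  if i = 0 then Γ.next (Γ.next h)
  else if i = 1 then (if Γ.isOver h then Γ.next.symm h else Γ.next h)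
  else (if Γ.isOver h then Γ.next h else Γ.next.symm h)

/-- The screw-orientation along the edges: the sheet `{h, y}` follows the sheet `{h, x}` in the
cyclic order of the three sheets along `h`. -/
def Follows (Γ : OGraph V H) (h x y : H) : Prop :=
  ∃ i : ZMod 3, x = Γ.sheet h i ∧ y = Γ.sheet h (i + 1)

/-- The gluing of sheets along edges: the sheet `{h, x}` at one end of an edge is glued to the
sheet `{h', x'}` at its other end. The gluing reverses the two cyclic orders, as these are seen
by the observers leaving the two ends of the edge; colour `0` means that the wall is glued to the
wall, and colour `c` means that the wall at `h` is glued to the sheet which comes `c` steps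
clockwise after the wall at `h'`, for an observer leaving along `h'`. This is symmetric in `h` and
`h'`, since a screw has the same handedness from both ends. -/
def Glued (Γ : OGraph V H) (h x h' x' : H) : Prop :=
  h' = Γ.opp h ∧ ∃ i : ZMod 3, x = Γ.sheet h i ∧ x' = Γ.sheet h' (Γ.colour h - i)

/-- The oriented standard polyhedra defined by `Γ` and `Δ` are isomorphic: there is a bijection
between their singular graphs which respects the screw-orientations and the gluings of the
sheets. -/
def SamePolyhedron (Γ : OGraph V H) (Δ : OGraph V' H') : Prop :=
  ∃ (f : V ≃ V') (e : H ≃ H'),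
    (∀ h, Δ.vert (e h) = f (Γ.vert h)) ∧
    (∀ h, Δ.opp (e h) = e (Γ.opp h)) ∧
    (∀ h x y, Δ.Follows (e h) (e x) (e y) ↔ Γ.Follows h x y) ∧
    (∀ h x h' x', Δ.Glued (e h) (e x) (e h') (e x') ↔ Γ.Glued h x h' x')

/-! ### The open chain -/

/-- The four germs of a crossing `X`, in counterclockwise order. -/
abbrev NE : Fin 4 := 0
/-- The upper left germ. -/
abbrev NW : Fin 4 := 1
/-- The lower left germ. -/
abbrev SW : Fin 4 := 2
/-- The lower right germ. -/
abbrev SE : Fin 4 := 3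

/-- The other end of each germ in the open chain with vertices `0, …, m` from left to right: the
two left germs of the first vertex are joined to each other, so are the two right germs of the last
vertex, and the right germs of the vertex `k` are joined to the left germs of the vertex `k + 1`,
the upper one to the upper one and the lower one to the lower one. -/
def chainOpp (m : ℕ) : Fin (m + 1) × Fin 4 → Fin (m + 1) × Fin 4
  | (v, 0) => Fin.lastCases (motive := fun _ => Fin (m + 1) × Fin 4)
      (Fin.last m, SE) (fun k => (k.succ, NW)) v
  | (v, 1) => Fin.cases (motive := fun _ => Fin (m + 1) × Fin 4)
      (0, SW) (fun k => (k.castSucc, NE)) v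
  | (v, 2) => Fin.cases (motive := fun _ => Fin (m + 1) × Fin 4)
      (0, NW) (fun k => (k.castSucc, SE)) v
  | (v, 3) => Fin.lastCases (motive := fun _ => Fin (m + 1) × Fin 4)
      (Fin.last m, NE) (fun k => (k.succ, SW)) v

/-- The colours of the open chain: `α` on the left loop, `δ` on the right loop, and `β k` on the
upper, `γ k` on the lower edge from the vertex `k` to the vertex `k + 1`. -/
def chainColour (m : ℕ) (α δ : ZMod 3) (β γ : Fin m → ZMod 3) : Fin (m + 1) × Fin 4 → ZMod 3
  | (v, 0) => Fin.lastCases (motive := fun _ => ZMod 3) δ β v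
  | (v, 1) => Fin.cases (motive := fun _ => ZMod 3) α β v
  | (v, 2) => Fin.cases (motive := fun _ => ZMod 3) α γ v
  | (v, 3) => Fin.lastCases (motive := fun _ => ZMod 3) δ γ v

/-- Counterclockwise rotation of the germs at each vertex of the open chain. -/
def chainNext (m : ℕ) : Equiv.Perm (Fin (m + 1) × Fin 4) :=
  Equiv.prodCongr (Equiv.refl _) (Equiv.addRight 1)

theorem chainNext_apply (m : ℕ) (h : Fin (m + 1) × Fin 4) :
    chainNext m h = (h.1, h.2 + 1) := rfl

theorem chainNext_pow (m : ℕ) (h : Fin (m + 1) × Fin 4) (k : ℕ) :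
    ((chainNext m) ^ k) h = (h.1, h.2 + Fin.ofNat 4 k) := by
  induction k with
  | zero => ext <;> simp
  | succ k ih =>
    rw [pow_succ', Equiv.Perm.mul_apply, ih, chainNext_apply]
    refine Prod.ext rfl ?_
    apply Fin.ext
    simp [Fin.val_add, Fin.ofNat]
    omega

/-- The o-graph based on the open chain with `m + 1` vertices, drawn as a horizontal row of equal
crossings `X` in each of which the strand from lower left to upper right is over, with colours
`α`, `δ`, `β k`, `γ k` as in `chainColour`. -/
def openChain (m : ℕ) (α δ : ZMod 3) (β γ : Fin m → ZMod 3) :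
    OGraph (Fin (m + 1)) (Fin (m + 1) × Fin 4) where
  finite_vertices := inferInstance
  vert := Prod.fst
  vert_surjective := Prod.fst_surjective
  opp := chainOpp m
  opp_opp := by
    rintro ⟨v, c⟩
    fin_cases c
    · refine Fin.lastCases ?_ (fun k => ?_) v <;> simp [chainOpp]
    · refine Fin.cases ?_ (fun k => ?_) v <;> simp [chainOpp]
    · refine Fin.cases ?_ (fun k => ?_) v <;> simp [chainOpp]
    · refine Fin.lastCases ?_ (fun k => ?_) v <;> simp [chainOpp]
  opp_ne := by
    rintro ⟨v, c⟩
    fin_cases c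
    · refine Fin.lastCases ?_ (fun k => ?_) v <;> (intro e; replace e := congrArg Prod.snd e; revert e; simp [chainOpp] <;> decide)
    · refine Fin.cases ?_ (fun k => ?_) v <;> (intro e; replace e := congrArg Prod.snd e; revert e; simp [chainOpp] <;> decide)
    · refine Fin.cases ?_ (fun k => ?_) v <;> (intro e; replace e := congrArg Prod.snd e; revert e; simp [chainOpp] <;> decide)
    · refine Fin.lastCases ?_ (fun k => ?_) v <;> (intro e; replace e := congrArg Prod.snd e; revert e; simp [chainOpp] <;> decide)
  next := chainNext m
  vert_eq_iff := by
    rintro ⟨v, c⟩ ⟨w, d⟩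
    constructor
    · rintro (rfl : v = w)
      refine ⟨((d - c : Fin 4) : ℕ), ?_⟩
      rw [zpow_natCast, chainNext_pow]
      simp
    · intro hs
      have nat : ∀ (k : ℕ) (x : Fin (m + 1) × Fin 4), ((chainNext m ^ k) x).1 = x.1 :=
        fun k x => by rw [chainNext_pow]
      obtain ⟨i, hi⟩ := hs
      have all : ∀ (i : ℤ) (x : Fin (m + 1) × Fin 4), ((chainNext m ^ i) x).1 = x.1 := by
        intro i x
        obtain ⟨k, rfl | rfl⟩ := i.eq_nat_or_neg
        · exact nat k x
        · have := nat k ((chainNext m ^ (-(k : ℤ))) x)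
          rw [← zpow_natCast, ← Equiv.Perm.mul_apply, ← zpow_add] at this
          simpa using this.symm
      have := all i (v, c)
      rw [hi] at this
      exact this.symm
  next_next_ne := by
    rintro ⟨v, c⟩
    simp only [chainNext_apply, ne_eq, Prod.mk.injEq, true_and]
    revert c
    decide
  next_four := by
    rintro ⟨v, c⟩
    simp only [chainNext_apply, Prod.mk.injEq, true_and]
    revert c
    decide
  isOver h := decide (h.2 = NE ∨ h.2 = SW)
  isOver_next := by
    rintro ⟨v, c⟩
    simp only [chainNext_apply]
    fin_cases c <;> rfl
  colour := chainColour m α δ β γ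
  colour_opp := by
    rintro ⟨v, c⟩
    fin_cases c
    · refine Fin.lastCases ?_ (fun k => ?_) v <;> simp [chainOpp, chainColour]
    · refine Fin.cases ?_ (fun k => ?_) v <;> simp [chainOpp, chainColour]
    · refine Fin.cases ?_ (fun k => ?_) v <;> simp [chainOpp, chainColour]
    · refine Fin.lastCases ?_ (fun k => ?_) v <;> simp [chainOpp, chainColour]

end OGraph

/-! In `-Γ` the overstrand at every crossing is the one through NW and SE. A C-move about either of
these germs restores a crossing with SW–NE over, after exchanging two germs on one side: the right
ones for a move about SE, the left ones for a move about NW. Alternating the two choices along the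
row makes both ends of each connecting pair of edges agree: between two neighbours the germs are
exchanged at both ends (the upper and lower edges trade places) or at neither. The germs moved about
are all over, so each end of an edge contributes `-1`; a colour `c` of `Γ` becomes `-c - 2 = 1 - c`
in `ℤ/3`. This is carried by `exists_cMoves_mirror_openChain`, `chainSwap_chainOpp` and
`chainColour_chainSwap`.

The polyhedron is unaffected because a C-move only rotates the numbering of the sheets along each
germ (`sheet_cMove`), and the change of colour is exactly the sum of the rotations at the two ends
of the edge. -/

namespace OGraph

variable {V H V' H' V'' H'' : Type*}

/-! ### Germs at a vertex and the effect of a C-move -/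

/-- Over and under alternate around a vertex. Together with `next_next_ne` and `next_four` this
makes the four germs distinct, which is what evaluates the transpositions in `turnAbout`. -/
theorem next_ne (Γ : OGraph V H) (h : H) : Γ.next h ≠ h := fun e => by
  simpa [e] using Γ.isOver_next h

theorem next_symm_apply (Γ : OGraph V H) (h : H) :
    Γ.next.symm h = Γ.next (Γ.next (Γ.next h)) := by
  rw [Equiv.symm_apply_eq, Γ.next_four]

theorem next_next_next_ne (Γ : OGraph V H) (h : H) : Γ.next (Γ.next (Γ.next h)) ≠ h := fun e =>
  Γ.next_ne h (by simpa [e] using Γ.next_four h)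

/-- The germs at the vertex of `a` are the four iterates of `a` under `next`. -/
theorem eq_of_vert_eq (Γ : OGraph V H) {a h : H} (e : Γ.vert h = Γ.vert a) :
    h = a ∨ h = Γ.next a ∨ h = Γ.next (Γ.next a) ∨ h = Γ.next (Γ.next (Γ.next a)) := by
  obtain ⟨i, rfl⟩ := (Γ.vert_eq_iff a h).1 e.symm
  have four : Γ.next ^ (4 : ℤ) = 1 := by
    ext x
    exact Γ.next_four x
  obtain ⟨q, r, hr0, hr4, rfl⟩ : ∃ q r : ℤ, 0 ≤ r ∧ r < 4 ∧ i = 4 * q + r :=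
    ⟨i / 4, i % 4, by omega, by omega, by omega⟩
  rw [zpow_add, zpow_mul, four, one_zpow, one_mul]
  obtain rfl | rfl | rfl | rfl : r = 0 ∨ r = 1 ∨ r = 2 ∨ r = 3 := by omega
  · exact Or.inl rfl
  · exact Or.inr (Or.inl rfl)
  · exact Or.inr (Or.inr (Or.inl rfl))
  · exact Or.inr (Or.inr (Or.inr rfl))

section Moves

variable [DecidableEq H] (Γ : OGraph V H) (a : H)

theorem turnAbout_self : Γ.turnAbout a a = a := by
  rw [turnAbout, Equiv.Perm.mul_apply,
    Equiv.swap_apply_of_ne_of_ne (Γ.next_next_ne a).symm (Γ.next_next_next_ne a).symm,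
    Equiv.swap_apply_of_ne_of_ne (Γ.next_ne a).symm (Γ.next_next_ne a).symm]

theorem turnAbout_next : Γ.turnAbout a (Γ.next a) = Γ.next (Γ.next a) := by
  rw [turnAbout, Equiv.Perm.mul_apply,
    Equiv.swap_apply_of_ne_of_ne (Γ.next_ne _).symm (Γ.next_next_ne _).symm,
    Equiv.swap_apply_left]

theorem turnAbout_next_next :
    Γ.turnAbout a (Γ.next (Γ.next a)) = Γ.next (Γ.next (Γ.next a)) := by
  rw [turnAbout, Equiv.Perm.mul_apply, Equiv.swap_apply_left,
    Equiv.swap_apply_of_ne_of_ne (Γ.next_next_ne _) (Γ.next_ne _)]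

theorem turnAbout_next_next_next :
    Γ.turnAbout a (Γ.next (Γ.next (Γ.next a))) = Γ.next a := by
  rw [turnAbout, Equiv.Perm.mul_apply, Equiv.swap_apply_right, Equiv.swap_apply_right]

variable {a} in
theorem turnAbout_of_vert_ne {h : H} (e : Γ.vert h ≠ Γ.vert a) : Γ.turnAbout a h = h := by
  have key : ∀ x, Γ.vert x = Γ.vert a → h ≠ x := by
    rintro _ hx rfl
    exact e hx
  rw [turnAbout, Equiv.Perm.mul_apply, Equiv.swap_apply_of_ne_of_ne (x := h),
    Equiv.swap_apply_of_ne_of_ne]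
  all_goals exact key _ (by simp [vert_next])

variable [DecidableEq V]

/-- The move transports the planar structure along `turnAbout a`. Evaluating this and the next lemma
at the four germs gives the explicit tables below. -/
theorem cMove_next_turnAbout (h : H) :
    (Γ.cMove a).next (Γ.turnAbout a h) = Γ.turnAbout a (Γ.next h) := by
  simp [cMove]

theorem cMove_isOver_turnAbout (h : H) :
    (Γ.cMove a).isOver (Γ.turnAbout a h) = Γ.isOver h := by
  simp [cMove]

theorem cMove_next_self : (Γ.cMove a).next a = Γ.next (Γ.next a) := by
  simpa only [turnAbout_self, turnAbout_next] using Γ.cMove_next_turnAbout a a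

theorem cMove_next_next_next :
    (Γ.cMove a).next (Γ.next (Γ.next a)) = Γ.next (Γ.next (Γ.next a)) := by
  simpa only [turnAbout_next, turnAbout_next_next] using Γ.cMove_next_turnAbout a (Γ.next a)

theorem cMove_next_next_next_next :
    (Γ.cMove a).next (Γ.next (Γ.next (Γ.next a))) = Γ.next a := by
  simpa only [turnAbout_next_next, turnAbout_next_next_next] using
    Γ.cMove_next_turnAbout a (Γ.next (Γ.next a))

theorem cMove_next_next : (Γ.cMove a).next (Γ.next a) = a := by
  simpa only [turnAbout_next_next_next, Γ.next_four, turnAbout_self] using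
    Γ.cMove_next_turnAbout a (Γ.next (Γ.next (Γ.next a)))

theorem cMove_isOver_self : (Γ.cMove a).isOver a = Γ.isOver a := by
  simpa only [turnAbout_self] using Γ.cMove_isOver_turnAbout a a

theorem cMove_isOver_next : (Γ.cMove a).isOver (Γ.next a) = !Γ.isOver a := by
  simpa only [turnAbout_next_next_next, isOver_next, Bool.not_not] using
    Γ.cMove_isOver_turnAbout a (Γ.next (Γ.next (Γ.next a)))

theorem cMove_isOver_next_next :
    (Γ.cMove a).isOver (Γ.next (Γ.next a)) = !Γ.isOver a := by
  simpa only [turnAbout_next, isOver_next] using Γ.cMove_isOver_turnAbout a (Γ.next a)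

theorem cMove_isOver_next_next_next :
    (Γ.cMove a).isOver (Γ.next (Γ.next (Γ.next a))) = Γ.isOver a := by
  simpa only [turnAbout_next_next, isOver_next, Bool.not_not] using
    Γ.cMove_isOver_turnAbout a (Γ.next (Γ.next a))

variable {a} in
theorem cMove_next_of_vert_ne {h : H} (e : Γ.vert h ≠ Γ.vert a) :
    (Γ.cMove a).next h = Γ.next h := by
  have := Γ.cMove_next_turnAbout a h
  rwa [Γ.turnAbout_of_vert_ne e, Γ.turnAbout_of_vert_ne (by rwa [vert_next])] at this

variable {a} in
theorem cMove_isOver_of_vert_ne {h : H} (e : Γ.vert h ≠ Γ.vert a) :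
    (Γ.cMove a).isOver h = Γ.isOver h := by
  have := Γ.cMove_isOver_turnAbout a h
  rwa [Γ.turnAbout_of_vert_ne e] at this

/-- A C-move only renumbers the sheets along each germ, by a rotation. -/
theorem sheet_cMove (h : H) (i : ZMod 3) :
    (Γ.cMove a).sheet h i = Γ.sheet h (i - Γ.shift a h) := by
  unfold sheet shift
  -- With `next.symm` written as the cube of `next`, the sheets at the moved vertex involve only the
  -- four iterates of `a`, and the claim is a finite check.
  simp only [next_symm_apply]
  by_cases e : Γ.vert h = Γ.vert a
  · have t : ∀ i : ZMod 3, i = 0 ∨ i = 1 ∨ i = 2 := by decide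
    have d1 : (1 : ZMod 3) ≠ 0 := by decide
    have d2 : (2 : ZMod 3) ≠ 0 := by decide
    have d3 : (2 : ZMod 3) ≠ 1 := by decide
    have s1 : (0 - -1 : ZMod 3) = 1 := by decide
    have s2 : (1 - -1 : ZMod 3) = 2 := by decide
    have s3 : (2 - -1 : ZMod 3) = 0 := by decide
    have s4 : (0 - 1 : ZMod 3) = 2 := by decide
    have s6 : (2 - 1 : ZMod 3) = 1 := by decide
    rw [if_pos e]
    cases ho : Γ.isOver a <;>
    rcases Γ.eq_of_vert_eq e with e | e | e | e <;>
    rcases t i with rfl | rfl | rfl <;>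
    simp [e, ho, d1, d2, d3, s1, s2, s3, s4, s6, cMove_next_self, cMove_next_next,
      cMove_next_next_next, cMove_next_next_next_next, cMove_isOver_self, cMove_isOver_next,
      cMove_isOver_next_next, cMove_isOver_next_next_next, isOver_next, next_four]
  · simp [e, cMove_next_of_vert_ne, cMove_isOver_of_vert_ne, vert_next]

end Moves

/-! ### Invariance of the polyhedron -/

namespace SamePolyhedron

theorem trans {Γ : OGraph V H} {Δ : OGraph V' H'} {Θ : OGraph V'' H''}
    (hΓ : Γ.SamePolyhedron Δ) (hΔ : Δ.SamePolyhedron Θ) : Γ.SamePolyhedron Θ := by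
  obtain ⟨f, e, h1, h2, h3, h4⟩ := hΓ
  obtain ⟨f', e', k1, k2, k3, k4⟩ := hΔ
  exact ⟨f.trans f', e.trans e', fun h => by simp [h1, k1], fun h => by simp [h2, k2],
    fun h x y => (k3 _ _ _).trans (h3 _ _ _), fun h x h' x' => (k4 _ _ _ _).trans (h4 _ _ _ _)⟩

theorem refl (Γ : OGraph V H) : Γ.SamePolyhedron Γ :=
  ⟨Equiv.refl _, Equiv.refl _, fun _ => rfl, fun _ => rfl, fun _ _ _ => Iff.rfl,
    fun _ _ _ _ => Iff.rfl⟩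

/-- The identity on germs works. Reindexing by `i ↦ i - shift` preserves the cyclic order of the
sheets, and in the gluing rule the shifts at the two ends cancel the two terms added to the colour.
-/
theorem of_cMove [DecidableEq H] [DecidableEq V] (Γ : OGraph V H) (a : H) :
    Γ.SamePolyhedron (Γ.cMove a) := by
  refine ⟨Equiv.refl _, Equiv.refl _, fun _ => rfl, fun _ => rfl, fun h x y => ?_,
    fun h x h' x' => ?_⟩
  · simp only [Follows, sheet_cMove, Equiv.refl_apply]
    refine (Equiv.subRight (Γ.shift a h)).exists_congr fun i => ?_
    simp only [Equiv.subRight_apply, sub_add_eq_add_sub]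
  · simp only [Glued, sheet_cMove, Equiv.refl_apply]
    refine and_congr_right fun hh => (Equiv.subRight (Γ.shift a h)).exists_congr fun i => ?_
    have hh' : h' = Γ.opp h := hh
    have : (Γ.cMove a).colour h - i - Γ.shift a h' = Γ.colour h - (i - Γ.shift a h) := by
      simp only [cMove, hh']
      ring
    rw [this, Equiv.subRight_apply]

theorem of_iso {Γ : OGraph V H} {Δ : OGraph V' H'} (φ : Iso Γ Δ) : Γ.SamePolyhedron Δ := by
  have sh : ∀ h i, Δ.sheet (φ.onGerm h) i = φ.onGerm (Γ.sheet h i) := fun h i => by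
    simp only [sheet, next_symm_apply, φ.next_comm, φ.isOver_comm]
    split_ifs <;> rfl
  refine ⟨φ.onVert, φ.onGerm, φ.vert_comm, φ.opp_comm, fun h x y => ?_, fun h x h' x' => ?_⟩
  · simp only [Follows, sh, EmbeddingLike.apply_eq_iff_eq]
  · simp only [Glued, sh, φ.opp_comm, φ.colour_comm, EmbeddingLike.apply_eq_iff_eq]

end SamePolyhedron

theorem CEquiv.samePolyhedron [DecidableEq H] [DecidableEq V] {Γ : OGraph V H}
    {Δ : OGraph V' H'} (hΓ : Γ.CEquiv Δ) : Γ.SamePolyhedron Δ := by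
  obtain ⟨Γ', hs, ⟨φ⟩⟩ := hΓ
  refine SamePolyhedron.trans ?_ (.of_iso φ)
  clear φ
  induction hs with
  | refl => exact .refl Γ
  | tail _ hstep ih =>
    obtain ⟨a, rfl⟩ := hstep
    exact ih.trans (.of_cMove _ a)

/-! ### The mirror of the open chain -/

/-- Exchange of the two right germs at the vertices of even index and of the two left germs at the
vertices of odd index. -/
def chainSwap (m : ℕ) : Equiv.Perm (Fin (m + 1) × Fin 4) :=
  Equiv.prodShear (Equiv.refl _) fun v =>
    if Even v.val then Equiv.swap NE SE else Equiv.swap NW SW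

theorem chainSwap_of_even {m : ℕ} {v : Fin (m + 1)} (hv : Even v.val) (c : Fin 4) :
    chainSwap m (v, c) = (v, Equiv.swap NE SE c) := by
  simp [chainSwap, hv]

theorem chainSwap_of_not_even {m : ℕ} {v : Fin (m + 1)} (hv : ¬ Even v.val) (c : Fin 4) :
    chainSwap m (v, c) = (v, Equiv.swap NW SW c) := by
  simp [chainSwap, hv]

/-- The C-moves at the vertices of index less than `j`, about the lower right germ for an even
index and about the upper left germ for an odd index. -/
theorem exists_cMoves_mirror_openChain (m : ℕ) (α δ : ZMod 3) (β γ : Fin m → ZMod 3) (j : ℕ)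
    (hj : j ≤ m + 1) :
    ∃ Δ, Relation.ReflTransGen CStep (openChain m α δ β γ).mirror Δ ∧
      Δ.vert = Prod.fst ∧ Δ.opp = chainOpp m ∧
      (∀ h, h.1.val < j → chainSwap m (Δ.next h) = chainNext m (chainSwap m h) ∧
        Δ.isOver h = (openChain m α δ β γ).isOver (chainSwap m h)) ∧
      (∀ h, j ≤ h.1.val → Δ.next h = chainNext m h ∧
        Δ.isOver h = !(openChain m α δ β γ).isOver h) ∧
      (∀ h, Δ.colour h = -chainColour m α δ β γ h + (if h.1.val < j then -1 else 0) +
        (if (chainOpp m h).1.val < j then -1 else 0)) := by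
  induction j with
  | zero =>
    exact ⟨_, .refl, rfl, rfl, by simp, fun h _ => ⟨rfl, rfl⟩, fun h => by simp; rfl⟩
  | succ j ih =>
    obtain ⟨Δ, hs, hv, ho, hlt, hge, hc⟩ := ih (by omega)
    let v : Fin (m + 1) := ⟨j, by omega⟩
    -- SE and NW both lie on the understrand of the chain, hence on the overstrand of its mirror; so
    -- either choice contributes `-1` to the colours.
    obtain ⟨a, hav, haO, ha⟩ : ∃ a : Fin (m + 1) × Fin 4, a.1 = v ∧
        (openChain m α δ β γ).isOver a = false ∧ a.2 = if Even j then SE else NW := by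
      refine ⟨(v, if Even j then SE else NW), rfl, ?_, rfl⟩
      split_ifs <;> rfl
    obtain ⟨w, c⟩ := a
    obtain rfl : w = v := hav
    have ha' : Δ.isOver (v, c) = true := by
      rw [(hge (v, c) le_rfl).2, haO]
      rfl
    have hn : ∀ c, Δ.next (v, c) = (v, c + 1) := fun c => (hge (v, c) le_rfl).1
    have hvne : ∀ h : Fin (m + 1) × Fin 4, h.1.val ≠ j → Δ.vert h ≠ Δ.vert (v, c) :=
      fun h hh e => hh (by rw [hv] at e; exact congrArg Fin.val e)
    have hshift : ∀ h, (if h.1.val < j then (-1 : ZMod 3) else 0) + Δ.shift (v, c) h =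
        if h.1.val < j + 1 then -1 else 0 := by
      intro h
      rcases lt_trichotomy h.1.val j with hh | hh | hh
      · rw [shift, if_neg (hvne h hh.ne), if_pos hh, if_pos (by omega), add_zero]
      · have hm : Δ.vert h = Δ.vert (v, c) := by
          rw [hv]
          exact Fin.ext hh
        simp [shift, hm, ha', hh]
      · rw [shift, if_neg (hvne h hh.ne'), if_neg (by omega), if_neg (by omega), add_zero]
    refine ⟨Δ.cMove (v, c), hs.tail ⟨_, rfl⟩, hv, ho, fun h hh => ?_, fun h hh => ?_, fun h => ?_⟩
    · rcases Nat.lt_succ_iff_lt_or_eq.1 hh with hh | hh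
      · rw [Δ.cMove_next_of_vert_ne (hvne h hh.ne), Δ.cMove_isOver_of_vert_ne (hvne h hh.ne)]
        exact hlt h hh
      · have hm : Δ.vert h = Δ.vert (v, c) := by
          rw [hv]
          exact Fin.ext hh
        have n0 := Δ.cMove_next_self (v, c)
        have n1 := Δ.cMove_next_next (v, c)
        have n2 := Δ.cMove_next_next_next (v, c)
        have n3 := Δ.cMove_next_next_next_next (v, c)
        have o0 := Δ.cMove_isOver_self (v, c)
        have o1 := Δ.cMove_isOver_next (v, c)
        have o2 := Δ.cMove_isOver_next_next (v, c)
        have o3 := Δ.cMove_isOver_next_next_next (v, c)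
        have hm := Δ.eq_of_vert_eq hm
        simp only [hn, ha'] at n0 n1 n2 n3 o0 o1 o2 o3 hm
        by_cases hp : Even j
        -- The order SE, NE, NW, SW becomes SE, NW, SW, NE with SE, SW over; exchanging NE and SE
        -- gives the standard crossing.
        · obtain rfl : c = SE := by simpa [hp] using ha
          rcases hm with rfl | rfl | rfl | rfl
          · rw [n0, o0, chainSwap_of_even hp, chainSwap_of_even hp]
            exact ⟨rfl, rfl⟩
          · rw [n1, o1, chainSwap_of_even hp, chainSwap_of_even hp]
            exact ⟨rfl, rfl⟩
          · rw [n2, o2, chainSwap_of_even hp, chainSwap_of_even hp]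
            exact ⟨rfl, rfl⟩
          · rw [n3, o3, chainSwap_of_even hp, chainSwap_of_even hp]
            exact ⟨rfl, rfl⟩
        -- The order NW, SW, SE, NE becomes NW, SE, NE, SW with NW, NE over; exchanging NW and SW
        -- gives the standard crossing.
        · obtain rfl : c = NW := by simpa [hp] using ha
          rcases hm with rfl | rfl | rfl | rfl
          · rw [n0, o0, chainSwap_of_not_even hp, chainSwap_of_not_even hp]
            exact ⟨rfl, rfl⟩
          · rw [n1, o1, chainSwap_of_not_even hp, chainSwap_of_not_even hp]
            exact ⟨rfl, rfl⟩
          · rw [n2, o2, chainSwap_of_not_even hp, chainSwap_of_not_even hp]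
            exact ⟨rfl, rfl⟩
          · rw [n3, o3, chainSwap_of_not_even hp, chainSwap_of_not_even hp]
            exact ⟨rfl, rfl⟩
    · have hne : h.1.val ≠ j := by omega
      rw [Δ.cMove_next_of_vert_ne (hvne h hne), Δ.cMove_isOver_of_vert_ne (hvne h hne)]
      exact hge h (by omega)
    · rw [← hshift, ← hshift]
      simp only [cMove, hc, ho]
      ring

/-- The right germs of vertex `k` and the left germs of vertex `k + 1` are exchanged together when
`k` is even and are both fixed when `k` is odd. The two germs of a loop are either fixed or
interchanged, which commutes with `chainOpp`. -/
theorem chainSwap_chainOpp (m : ℕ) (h : Fin (m + 1) × Fin 4) :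
    chainOpp m (chainSwap m h) = chainSwap m (chainOpp m h) := by
  have s0 : Equiv.swap NE SE NW = NW := by decide
  have s1 : Equiv.swap NE SE SW = SW := by decide
  have s2 : Equiv.swap NW SW NE = NE := by decide
  have s3 : Equiv.swap NW SW SE = SE := by decide
  obtain ⟨v, c⟩ := h
  have cc : c = NE ∨ c = NW ∨ c = SW ∨ c = SE := by revert c; decide
  rcases cc with rfl | rfl | rfl | rfl
  · refine Fin.lastCases ?_ (fun k => ?_) v
    · by_cases hp : Even m <;> simp [chainOpp, chainSwap, hp, s2, s3]
    · by_cases hp : Even k.val <;> simp [chainOpp, chainSwap, hp, s0, s2, Nat.even_add_one]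
  · refine Fin.cases ?_ (fun k => ?_) v
    · simp [chainOpp, chainSwap, s0, s1]
    · by_cases hp : Even k.val <;> simp [chainOpp, chainSwap, hp, s0, s2, Nat.even_add_one]
  · refine Fin.cases ?_ (fun k => ?_) v
    · simp [chainOpp, chainSwap, s0, s1]
    · by_cases hp : Even k.val <;> simp [chainOpp, chainSwap, hp, s1, s3, Nat.even_add_one]
  · refine Fin.lastCases ?_ (fun k => ?_) v
    · by_cases hp : Even m <;> simp [chainOpp, chainSwap, hp, s2, s3]
    · by_cases hp : Even k.val <;> simp [chainOpp, chainSwap, hp, s1, s3, Nat.even_add_one]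

theorem chainColour_chainSwap {m : ℕ} {α δ α' δ' : ZMod 3} {β γ β' γ' : Fin m → ZMod 3}
    (hα : α' = 1 - α) (hδ : δ' = 1 - δ)
    (hβ_odd : ∀ k : Fin m, Odd (k.val + 1) → β' k = 1 - γ k)
    (hγ_odd : ∀ k : Fin m, Odd (k.val + 1) → γ' k = 1 - β k)
    (hβ_even : ∀ k : Fin m, Even (k.val + 1) → β' k = 1 - β k)
    (hγ_even : ∀ k : Fin m, Even (k.val + 1) → γ' k = 1 - γ k)
    (h : Fin (m + 1) × Fin 4) :
    chainColour m α' δ' β' γ' (chainSwap m h) = 1 - chainColour m α δ β γ h := by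
  have s0 : Equiv.swap NE SE NW = NW := by decide
  have s1 : Equiv.swap NE SE SW = SW := by decide
  have s2 : Equiv.swap NW SW NE = NE := by decide
  have s3 : Equiv.swap NW SW SE = SE := by decide
  -- Indices start at `0` here, so the pairs of edges that trade places, those leaving a vertex of
  -- even index, are the odd-numbered ones of the hypotheses.
  have even_iff : ∀ k : ℕ, Even k → Odd (k + 1) := fun k hk => hk.add_one
  have odd_iff : ∀ k : ℕ, ¬ Even k → Even (k + 1) := fun k hk => Nat.even_add_one.2 hk
  obtain ⟨v, c⟩ := h
  have cc : c = NE ∨ c = NW ∨ c = SW ∨ c = SE := by revert c; decide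
  rcases cc with rfl | rfl | rfl | rfl
  · refine Fin.lastCases ?_ (fun k => ?_) v
    · by_cases hp : Even m <;> simp [chainColour, chainSwap, hp, s2, hδ]
    · by_cases hp : Even k.val
      · simp [chainColour, chainSwap, hp, hγ_odd k (even_iff k hp)]
      · simp [chainColour, chainSwap, hp, s2, hβ_even k (odd_iff k hp)]
  · refine Fin.cases ?_ (fun k => ?_) v
    · simp [chainColour, chainSwap, s0, hα]
    · by_cases hp : Even k.val
      · simp [chainColour, chainSwap, hp, Nat.even_add_one, hγ_odd k (even_iff k hp)]
      · simp [chainColour, chainSwap, hp, s0, Nat.even_add_one, hβ_even k (odd_iff k hp)]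
  · refine Fin.cases ?_ (fun k => ?_) v
    · simp [chainColour, chainSwap, s1, hα]
    · by_cases hp : Even k.val
      · simp [chainColour, chainSwap, hp, Nat.even_add_one, hβ_odd k (even_iff k hp)]
      · simp [chainColour, chainSwap, hp, s1, Nat.even_add_one, hγ_even k (odd_iff k hp)]
  · refine Fin.lastCases ?_ (fun k => ?_) v
    · by_cases hp : Even m <;> simp [chainColour, chainSwap, hp, s3, hδ]
    · by_cases hp : Even k.val
      · simp [chainColour, chainSwap, hp, hβ_odd k (even_iff k hp)]
      · simp [chainColour, chainSwap, hp, s3, hγ_even k (odd_iff k hp)]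

end OGraph

theorem proposition2p10 (m : ℕ) (α δ : ZMod 3) (β γ : Fin m → ZMod 3)
    (α' δ' : ZMod 3) (β' γ' : Fin m → ZMod 3)
    (hα : α' = 1 - α) (hδ : δ' = 1 - δ)
    -- the entry `k : Fin m` is the one numbered `k + 1` when one counts from `1`
    (hβ_odd : ∀ k : Fin m, Odd (k.val + 1) → β' k = 1 - γ k)
    (hγ_odd : ∀ k : Fin m, Odd (k.val + 1) → γ' k = 1 - β k)
    (hβ_even : ∀ k : Fin m, Even (k.val + 1) → β' k = 1 - β k)
    (hγ_even : ∀ k : Fin m, Even (k.val + 1) → γ' k = 1 - γ k) :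
    (OGraph.openChain m α δ β γ).mirror.CEquiv (OGraph.openChain m α' δ' β' γ') ∧
      (OGraph.openChain m α δ β γ).mirror.SamePolyhedron
        (OGraph.openChain m α' δ' β' γ') := by
  have main : (OGraph.openChain m α δ β γ).mirror.CEquiv (OGraph.openChain m α' δ' β' γ') := by
    obtain ⟨Δ, hs, hv, ho, hlt, -, hc⟩ :=
      OGraph.exists_cMoves_mirror_openChain m α δ β γ (m + 1) le_rfl
    refine ⟨Δ, hs, ⟨{
      onVert := Equiv.refl _
      onGerm := OGraph.chainSwap m
      vert_comm := fun h => by rw [hv]; rfl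
      opp_comm := fun h => by rw [ho]; exact OGraph.chainSwap_chainOpp m h
      next_comm := fun h => (hlt h h.1.isLt).1.symm
      isOver_comm := fun h => (hlt h h.1.isLt).2.symm
      colour_comm := fun h => ?_ }⟩⟩
    -- All vertices have been moved, so both ends of every edge, loops included, contribute `-1`.
    rw [hc, if_pos h.1.isLt, if_pos (Fin.isLt _)]
    refine (OGraph.chainColour_chainSwap hα hδ hβ_odd hγ_odd hβ_even hγ_even h).trans ?_
    have two : (1 : ZMod 3) = -1 + -1 := by decide
    linear_combination two
  exact ⟨main, main.samePolyhedron⟩
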